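/- Let $G$ be a finite group with identity $e$ and let $H\neq\{e\}$ be a subgroup of $G$. The generalized non-coprime graph $\Gamma_{G,H}$ is the simple undirected graph with vertex set $G\setminus\{e\}$ in which two distinct vertices $a,b$ are adjacent if and only if $\gcd(|a|,|b|)\neq 1$ and at least one of $a,b$ lies in $H$, where $|x|$ denotes the order of $x$. A graph is perfect if each of its induced subgraphs has equal clique number and chromatic number. Let $G$ be a cyclic group of order $p_1p_2p_3p_4$, where $p_1,p_2,p_3,p_4$ are distinct primes, and let $H\neq\{e\}$ be a subgroup of $G$. Then $\Gamma_{G,H}$ is perfect. Moreover, if $|H|$ is not a product of three primes, then for every $n>4$ neither the cycle $C_n$ nor its complement is an induced subgraph of $\Gamma_{G,H}$; and if $|H|$ is a product of three primes, then $\Gamma_{G,H}$ contains the cycle $C_6$ as an induced subgraph. -/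

import Mathlib

/-- The generalized non-coprime graph `Γ_{G,H}` of a group `G` with respect to a subgroup `H`:
the vertices are the non-identity elements of `G`, and two distinct vertices are adjacent iff
their orders are not coprime and at least one of them lies in `H`. -/
def genNonCoprimeGraph {G : Type*} [Group G] (H : Subgroup G) :
    SimpleGraph {x : G // x ≠ 1} where
  Adj a b := a ≠ b ∧ Nat.gcd (orderOf (a : G)) (orderOf (b : G)) ≠ 1 ∧
    ((a : G) ∈ H ∨ (b : G) ∈ H)
  symm := ⟨fun _ _ h => ⟨h.1.symm, Nat.gcd_comm _ _ ▸ h.2.1, h.2.2.symm⟩⟩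
  loopless := ⟨fun _ h => h.1 rfl⟩

/-- A (finite) graph is perfect if the clique number and the chromatic number of each of its
induced subgraphs are equal. -/
def IsPerfectGraph {V : Type*} (Γ : SimpleGraph V) : Prop :=
  ∀ s : Set V, (Γ.induce s).chromaticNumber = ((Γ.induce s).cliqueNum : ℕ∞)

namespace SimpleGraph

variable {V : Type*} {Γ : SimpleGraph V}

/-- The neighbours of `v` inside `s` form a clique. -/
def IsSimplicialIn (Γ : SimpleGraph V) (s : Finset V) (v : V) : Prop :=
  ∀ w₁ ∈ s, ∀ w₂ ∈ s, Γ.Adj v w₁ → Γ.Adj v w₂ → w₁ ≠ w₂ → Γ.Adj w₁ w₂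

/-- A nonempty independent subset `I` of `s` such that every clique of `s` avoiding `I` can be
extended by a vertex of `I`; in particular `I` meets every maximal clique of `s`. -/
structure IsCliqueTransversalIn (Γ : SimpleGraph V) (s I : Finset V) : Prop where
  subset : I ⊆ s
  nonempty : I.Nonempty
  indep : ∀ u ∈ I, ∀ v ∈ I, ¬ Γ.Adj u v
  extend : ∀ K ⊆ s, Γ.IsClique K → Disjoint K I → ∃ u ∈ I, ∀ w ∈ K, Γ.Adj u w

/-- If every nonempty vertex set has a simplicial vertex or an independent clique transversal, then
every vertex set can be properly coloured with as many colours as its largest clique has vertices. -/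
theorem exists_coloring_of_forall_simplicial_or_transversal
    (h : ∀ s : Finset V, s.Nonempty →
      (∃ v ∈ s, Γ.IsSimplicialIn s v) ∨ ∃ I, Γ.IsCliqueTransversalIn s I)
    (s : Finset V) (k : ℕ) (hk : ∀ K ⊆ s, Γ.IsClique K → K.card ≤ k) :
    ∃ c : V → ℕ, (∀ v ∈ s, c v < k) ∧ ∀ v ∈ s, ∀ w ∈ s, Γ.Adj v w → c v ≠ c w := by
  classical
  induction s using Finset.strongInduction generalizing k with
  | H s ih =>
  rcases s.eq_empty_or_nonempty with rfl | hs
  · exact ⟨fun _ => 0, by simp, by simp⟩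
  rcases h s hs with ⟨v, hv, hsimp⟩ | ⟨I, hI⟩
  · obtain ⟨c, hc, hadj⟩ := ih (s.erase v) (Finset.erase_ssubset hv) k
      fun K hK => hk K (hK.trans (Finset.erase_subset _ _))
    set N := s.filter (Γ.Adj v) with hN
    have hvN : v ∉ N := by simp [hN]
    have hclique : Γ.IsClique (insert v N : Finset V) := by
      rw [Finset.coe_insert, isClique_insert]
      refine ⟨fun a ha b hb hab => ?_, fun b hb _ => ?_⟩
      · simp only [hN, Finset.coe_filter, Set.mem_ofPred_eq] at ha hb
        exact hsimp a ha.1 b hb.1 ha.2 hb.2 hab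
      · simp only [hN, Finset.coe_filter, Set.mem_ofPred_eq] at hb
        exact hb.2
    have hcard := hk (insert v N)
      (Finset.insert_subset hv (Finset.filter_subset _ _)) hclique
    rw [Finset.card_insert_of_notMem hvN] at hcard
    obtain ⟨m, hm, hmN⟩ : ∃ m ∈ Finset.range k, m ∉ N.image c := by
      apply Finset.exists_mem_notMem_of_card_lt_card
      have := Finset.card_image_le (s := N) (f := c)
      rw [Finset.card_range]; omega
    have hm' : ∀ w ∈ s, Γ.Adj v w → c w ≠ m := fun w hw hvw hcw =>
      hmN (Finset.mem_image.2 ⟨w, by simp [hN, hw, hvw], hcw⟩)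
    refine ⟨Function.update c v m, fun w hw => ?_, fun a ha b hb hab => ?_⟩
    · by_cases hwv : w = v
      · subst hwv; simpa using hm
      · simpa [hwv] using hc w (by simp [hwv, hw])
    · by_cases hav : a = v
      · subst hav
        have hba : b ≠ a := hab.ne'
        simpa [hba] using (hm' b hb hab).symm
      · by_cases hbv : b = v
        · subst hbv
          simpa [hav] using hm' a ha hab.symm
        · simpa [hav, hbv] using hadj a (by simp [hav, ha]) b (by simp [hbv, hb]) hab
  · obtain ⟨u₀, hu₀⟩ := hI.nonempty
    have hk1 : 1 ≤ k := by
      simpa using hk {u₀} (by simpa using hI.subset hu₀) (by simp)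
    obtain ⟨c, hc, hadj⟩ := ih (s \ I) (Finset.sdiff_ssubset hI.subset hI.nonempty) (k - 1) (by
      intro K hK hKc
      have hKI : Disjoint K I := Finset.disjoint_of_subset_left hK Finset.sdiff_disjoint
      have hKs : K ⊆ s := hK.trans Finset.sdiff_subset
      obtain ⟨u, hu, huK⟩ := hI.extend K hKs hKc hKI
      have huK' : u ∉ K := fun h' => Finset.disjoint_left.1 hKI h' hu
      have := hk (insert u K) (Finset.insert_subset (hI.subset hu) hKs) (by
        rw [Finset.coe_insert, isClique_insert]
        exact ⟨hKc, fun b hb _ => huK b hb⟩)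
      rw [Finset.card_insert_of_notMem huK'] at this
      omega)
    refine ⟨fun v => if v ∈ I then k - 1 else c v, fun v hv => ?_, fun a ha b hb hab => ?_⟩
    · dsimp only
      split_ifs with hvI
      · omega
      · have := hc v (by simp [hv, hvI]); omega
    · dsimp only
      split_ifs with haI hbI hbI
      · exact absurd hab (hI.indep a haI b hbI)
      · have := hc b (by simp [hb, hbI]); omega
      · have := hc a (by simp [ha, haI]); omega
      · exact hadj a (by simp [ha, haI]) b (by simp [hb, hbI]) hab

theorem isPerfectGraph_of_forall_simplicial_or_transversal [Finite V]
    (h : ∀ s : Finset V, s.Nonempty →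
      (∃ v ∈ s, Γ.IsSimplicialIn s v) ∨ ∃ I, Γ.IsCliqueTransversalIn s I) :
    IsPerfectGraph Γ := by
  classical
  intro s
  refine le_antisymm ?_ (cliqueNum_le_chromaticNumber)
  have hfin := s.toFinite
  obtain ⟨c, hc, hadj⟩ := exists_coloring_of_forall_simplicial_or_transversal h
    hfin.toFinset (Γ.induce s).cliqueNum (by
      intro K hK hKc
      have hKs : ∀ x ∈ K, x ∈ s := fun x hx => by simpa using hK hx
      have hclique : (Γ.induce s).IsClique (K.subtype (· ∈ s)) := by
        intro a ha b hb hab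
        rw [Finset.mem_coe, Finset.mem_subtype] at ha hb
        exact hKc ha hb (fun h' => hab (Subtype.ext h'))
      have := IsClique.card_le_cliqueNum (tc := hclique)
      rwa [Finset.card_subtype, Finset.filter_true_of_mem hKs] at this)
  rw [chromaticNumber_le_iff_colorable]
  refine ⟨Coloring.mk (fun v => ⟨c v, hc v (by simp)⟩) fun {a b} hab h' => ?_⟩
  exact hadj a (by simp) b (by simp) hab (by simpa using h')

/-- `Γ` is the graph in which distinct vertices are joined iff their labels `f v` meet and one of
these labels lies in `T`. -/
def IsMeetGraph {α : Type*} [DecidableEq α] (Γ : SimpleGraph V) (f : V → Finset α)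
    (T : Finset α) : Prop :=
  ∀ v w, Γ.Adj v w ↔ v ≠ w ∧ (f v ∩ f w).Nonempty ∧ (f v ⊆ T ∨ f w ⊆ T)

section MeetGraph

variable {α : Type*} [DecidableEq α] {f : V → Finset α} {T : Finset α}

theorem IsMeetGraph.adj_or_disjoint (hΓ : Γ.IsMeetGraph f T) {v w : V} (hne : v ≠ w)
    (hT : f v ⊆ T ∨ f w ⊆ T) : Γ.Adj v w ∨ Disjoint (f v) (f w) := by
  by_cases h : Disjoint (f v) (f w)
  · exact .inr h
  · exact .inl ((hΓ v w).2 ⟨hne, Finset.not_disjoint_iff_nonempty_inter.1 h, hT⟩)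

/-- If the vertices of `s` disjoint from `v` all carry the same label, then `v`, possibly together
with one of them, is an independent clique transversal. -/
theorem IsMeetGraph.exists_transversal (hΓ : Γ.IsMeetGraph f T) (hne : ∀ v, (f v).Nonempty)
    {s : Finset V} {v : V} (hv : v ∈ s) (hvT : f v ⊆ T)
    (hin : ∀ w ∈ s, Disjoint (f v) (f w) → f w ⊆ T)
    (heq : ∀ w₁ ∈ s, ∀ w₂ ∈ s, Disjoint (f v) (f w₁) → Disjoint (f v) (f w₂) → f w₁ = f w₂) :
    ∃ I, Γ.IsCliqueTransversalIn s I := by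
  classical
  by_cases hex : ∃ u ∈ s, Disjoint (f v) (f u)
  · obtain ⟨u, hu, huv⟩ := hex
    have hnadj : ¬ Γ.Adj v u := fun h => by
      have := ((hΓ v u).1 h).2.1
      rw [Finset.disjoint_iff_inter_eq_empty.1 huv] at this
      exact Finset.not_nonempty_empty this
    refine ⟨{v, u}, ?_, by simp, ?_, ?_⟩
    · intro x hx
      rcases Finset.mem_insert.1 hx with rfl | hx
      · exact hv
      · rwa [Finset.mem_singleton.1 hx]
    · simp [hnadj, mt Γ.adj_symm hnadj]
    · intro K hK hKc hKI
      have hvK : ∀ w ∈ K, v ≠ w := by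
        rintro w hw rfl
        exact Finset.disjoint_left.1 hKI hw (by simp)
      have huK : ∀ w ∈ K, u ≠ w := by
        rintro w hw rfl
        exact Finset.disjoint_left.1 hKI hw (by simp)
      by_cases hall : ∀ w ∈ K, Γ.Adj v w
      · exact ⟨v, by simp, hall⟩
      · push Not at hall
        obtain ⟨w, hw, hvw⟩ := hall
        have hdisj := (hΓ.adj_or_disjoint (hvK w hw) (.inl hvT)).resolve_left hvw
        have hfw : f w = f u := heq w (hK hw) u hu hdisj huv
        refine ⟨u, by simp, fun x hx => (hΓ u x).2 ⟨huK x hx, ?_, .inl (hin u hu huv)⟩⟩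
        rw [← hfw]
        by_cases hwx : w = x
        · subst hwx; simpa using hne w
        · exact ((hΓ w x).1 (hKc hw hx hwx)).2.1
  · push Not at hex
    refine ⟨{v}, by simpa using hv, by simp, by simp, fun K hK _ hKI => ⟨v, by simp, ?_⟩⟩
    intro w hw
    refine (hΓ.adj_or_disjoint ?_ (.inl hvT)).resolve_right (hex w (hK hw))
    rintro rfl
    exact Finset.disjoint_left.1 hKI hw (by simp)

/-- A vertex meeting its neighbours only in one fixed point of the labels is simplicial if its
neighbours have their labels in `T`. -/
theorem IsMeetGraph.isSimplicialIn (hΓ : Γ.IsMeetGraph f T) {s : Finset V} {v : V}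
    (hcard : (f v ∩ T).card ≤ 1) (hin : ∀ w ∈ s, Γ.Adj v w → f w ⊆ T) :
    Γ.IsSimplicialIn s v := by
  intro w₁ hw₁ w₂ hw₂ h₁ h₂ hne
  obtain ⟨a, ha⟩ := ((hΓ _ _).1 h₁).2.1
  obtain ⟨b, hb⟩ := ((hΓ _ _).1 h₂).2.1
  rw [Finset.mem_inter] at ha hb
  have hab : a = b := Finset.card_le_one.1 hcard a
    (Finset.mem_inter.2 ⟨ha.1, hin w₁ hw₁ h₁ ha.2⟩) b
    (Finset.mem_inter.2 ⟨hb.1, hin w₂ hw₂ h₂ hb.2⟩)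
  subst hab
  exact (hΓ _ _).2 ⟨hne, ⟨a, Finset.mem_inter.2 ⟨ha.2, hb.2⟩⟩, .inl (hin w₁ hw₁ h₁)⟩

/-- When all labels contained in `T` are singletons, one vertex for each of these labels makes up an
independent clique transversal, unless some vertex is simplicial. -/
theorem IsMeetGraph.simplicial_or_transversal_of_singletons (hΓ : Γ.IsMeetGraph f T)
    (hne : ∀ v, (f v).Nonempty) {s : Finset V} (hs : s.Nonempty)
    (hsing : ∀ v ∈ s, f v ⊆ T → (f v).card ≤ 1) :
    (∃ v ∈ s, Γ.IsSimplicialIn s v) ∨ ∃ I, Γ.IsCliqueTransversalIn s I := by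
  classical
  by_cases hiso : ∃ v ∈ s, ∀ w ∈ s, ¬ Γ.Adj v w
  · obtain ⟨v, hv, hvs⟩ := hiso
    exact .inl ⟨v, hv, fun w hw _ _ h => absurd h (hvs w hw)⟩
  right
  push Not at hiso
  have hmeet : ∀ u ∈ s, ∀ x, f u ⊆ T → (f u ∩ f x).Nonempty → f u ⊆ f x := by
    rintro u hu x huT ⟨a, ha⟩ b hb
    rw [Finset.mem_inter] at ha
    rw [Finset.card_le_one.1 (hsing u hu huT) b hb a ha.1]
    exact ha.2
  obtain ⟨v₀, hv₀⟩ := hs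
  have hrep : ∀ A : Finset α, ∃ v, (∃ w ∈ s, f w = A) → v ∈ s ∧ f v = A := fun A => by
    by_cases h : ∃ w ∈ s, f w = A
    · obtain ⟨w, hw⟩ := h
      exact ⟨w, fun _ => hw⟩
    · exact ⟨v₀, fun h' => absurd h' h⟩
  choose r hr using hrep
  set I := s.filter fun v => f v ⊆ T ∧ r (f v) = v with hI
  have hrI : ∀ w ∈ s, f w ⊆ T → r (f w) ∈ I ∧ f (r (f w)) = f w := fun w hw hwT => by
    obtain ⟨h₁, h₂⟩ := hr (f w) ⟨w, hw, rfl⟩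
    refine ⟨Finset.mem_filter.2 ⟨h₁, ?_, ?_⟩, h₂⟩
    · rwa [h₂]
    · rw [h₂]
  have hext : ∀ x ∈ s, ∃ u ∈ I, f u ⊆ f x ∧ (f x ⊆ T → f u = f x) := fun x hx => by
    by_cases hxT : f x ⊆ T
    · obtain ⟨h₁, h₂⟩ := hrI x hx hxT
      exact ⟨_, h₁, h₂.le, fun _ => h₂⟩
    · obtain ⟨w, hw, hxw⟩ := hiso x hx
      obtain ⟨-, hn, hT⟩ := (hΓ _ _).1 hxw
      have hwT := hT.resolve_left hxT
      obtain ⟨h₁, h₂⟩ := hrI w hw hwT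
      refine ⟨_, h₁, ?_, fun h => absurd h hxT⟩
      rw [h₂]
      exact hmeet w hw x hwT (by rwa [Finset.inter_comm])
  refine ⟨I, Finset.filter_subset _ _, ?_, ?_, ?_⟩
  · obtain ⟨u, hu, -⟩ := hext v₀ hv₀
    exact ⟨u, hu⟩
  · intro u hu v hv huv
    rw [Finset.mem_filter] at hu hv
    obtain ⟨hne', hn, -⟩ := (hΓ _ _).1 huv
    have : f u = f v := (hmeet u hu.1 v hu.2.1 hn).antisymm
      (hmeet v hv.1 u hv.2.1 (by rwa [Finset.inter_comm]))
    exact hne' (by rw [← hu.2.2, ← hv.2.2, this])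
  · intro K hK hKc hKI
    have hKne : ∀ u ∈ I, ∀ w ∈ K, u ≠ w := by
      rintro u hu w hw rfl
      exact Finset.disjoint_left.1 hKI hw hu
    have key : ∀ x ∈ K, (f x ⊆ T ∨ ∀ y ∈ K, y = x) → ∃ u ∈ I, ∀ w ∈ K, Γ.Adj u w := by
      intro x hx hx'
      obtain ⟨u, hu, hux, huT⟩ := hext x (hK hx)
      have huT' := (Finset.mem_filter.1 hu).2.1
      refine ⟨u, hu, fun w hw => (hΓ _ _).2 ⟨hKne u hu w hw, ?_, .inl huT'⟩⟩
      by_cases hwx : w = x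
      · subst hwx
        rw [Finset.inter_eq_left.2 hux]
        exact hne u
      · rcases hx' with h | h
        · rw [huT h]
          exact ((hΓ _ _).1 (hKc hx hw (Ne.symm hwx))).2.1
        · exact absurd (h w hw) hwx
    by_cases hin : ∃ x ∈ K, f x ⊆ T
    · obtain ⟨x, hx, hxT⟩ := hin
      exact key x hx (.inl hxT)
    · push Not at hin
      rcases K.eq_empty_or_nonempty with rfl | ⟨x, hx⟩
      · obtain ⟨u, hu, -⟩ := hext v₀ hv₀
        exact ⟨u, hu, by simp⟩
      · refine key x hx (.inr fun y hy => ?_)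
        by_contra hyx
        rcases ((hΓ _ _).1 (hKc hy hx hyx)).2.2 with h | h
        · exact hin y hy h
        · exact hin x hx h

theorem IsMeetGraph.isPerfectGraph_of_card_le_three [Finite V] (hΓ : Γ.IsMeetGraph f T)
    (hne : ∀ v, (f v).Nonempty) (hT : T.card ≤ 3) : IsPerfectGraph Γ := by
  refine isPerfectGraph_of_forall_simplicial_or_transversal fun s hs => ?_
  by_cases hout : ∃ v ∈ s, ¬ f v ⊆ T ∧ (f v ∩ T).card ≤ 1
  · obtain ⟨v, hv, hvT, hcard⟩ := hout
    exact .inl ⟨v, hv, hΓ.isSimplicialIn hcard fun w _ h =>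
      (((hΓ _ _).1 h).2.2).resolve_left hvT⟩
  push Not at hout
  by_cases hbig : ∃ v ∈ s, f v ⊆ T ∧ 1 < (f v).card
  · right
    obtain ⟨v, hv, hvT, hcard⟩ := hbig
    have hrest : (T \ f v).card ≤ 1 := by
      rw [Finset.card_sdiff_of_subset hvT]; omega
    have hsub : ∀ w, Disjoint (f v) (f w) → f w ∩ T ⊆ T \ f v := fun w hw a ha => by
      rw [Finset.mem_inter] at ha
      exact Finset.mem_sdiff.2 ⟨ha.2, fun h => Finset.disjoint_left.1 hw h ha.1⟩
    have hin : ∀ w ∈ s, Disjoint (f v) (f w) → f w ⊆ T := fun w hw hd => by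
      by_contra hwT
      have := hout w hw hwT
      have := Finset.card_le_card (hsub w hd)
      omega
    have hfull : ∀ w ∈ s, Disjoint (f v) (f w) → f w = T \ f v := fun w hw hd => by
      have h := hsub w hd
      rw [Finset.inter_eq_left.2 (hin w hw hd)] at h
      exact Finset.eq_of_subset_of_card_le h (hrest.trans (hne w).card_pos)
    exact hΓ.exists_transversal hne hv hvT hin fun w₁ h₁ w₂ h₂ d₁ d₂ =>
      (hfull w₁ h₁ d₁).trans (hfull w₂ h₂ d₂).symm
  · push Not at hbig
    exact hΓ.simplicial_or_transversal_of_singletons hne hs hbig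

theorem eq_compl_of_disjoint_of_card_four [Fintype α] (hα : Fintype.card α = 4) {A B : Finset α}
    (hA : 1 < A.card) (hB : 1 < B.card) (h : Disjoint A B) : B = Aᶜ :=
  Finset.eq_of_subset_of_card_le (Finset.subset_compl_iff_disjoint_left.2 h)
    (by rw [Finset.card_compl]; omega)

theorem IsMeetGraph.isPerfectGraph_of_univ [Finite V] [Fintype α] (hα : Fintype.card α = 4)
    (hΓ : Γ.IsMeetGraph f Finset.univ) (hne : ∀ v, (f v).Nonempty) : IsPerfectGraph Γ := by
  refine isPerfectGraph_of_forall_simplicial_or_transversal fun s hs => ?_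
  by_cases hsmall : ∃ v ∈ s, (f v).card ≤ 1
  · obtain ⟨v, hv, hcard⟩ := hsmall
    exact .inl ⟨v, hv, hΓ.isSimplicialIn (by simpa using hcard) fun w _ _ =>
      Finset.subset_univ _⟩
  push Not at hsmall
  obtain ⟨v, hv⟩ := hs
  refine .inr (hΓ.exists_transversal hne hv (Finset.subset_univ _)
    (fun _ _ _ => Finset.subset_univ _) fun w₁ h₁ w₂ h₂ d₁ d₂ => ?_)
  rw [eq_compl_of_disjoint_of_card_four hα (hsmall v hv) (hsmall w₁ h₁) d₁,
    eq_compl_of_disjoint_of_card_four hα (hsmall v hv) (hsmall w₂ h₂) d₂]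

end MeetGraph
end SimpleGraph

namespace SimpleGraph

section NoLongHole

variable {V : Type*} {W : SimpleGraph V}

/-- `W` has no simplicial vertex, no universal vertex, and contains an induced path on four
vertices. -/
structure IsHoleLike [Fintype V] (W : SimpleGraph V) : Prop where
  not_simplicial : ∀ v, ¬ W.IsSimplicialIn Finset.univ v
  not_universal : ∀ v, ∃ w, v ≠ w ∧ ¬ W.Adj v w
  exists_path : ∃ a b c d, W.Adj a b ∧ W.Adj b c ∧ W.Adj c d ∧
    ¬ W.Adj a c ∧ ¬ W.Adj a d ∧ ¬ W.Adj b d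

variable [Fintype V] {α : Type*} [DecidableEq α] {f : V → Finset α} {T : Finset α}

theorem IsHoleLike.false_of_isMeetGraph (hW : W.IsHoleLike) (hΓ : W.IsMeetGraph f T)
    (hin : ∀ a c, a ≠ c → ¬ W.Adj a c → (∃ d, W.Adj c d ∧ ¬ W.Adj a d) →
      Disjoint (f a) (f c) ∧ f c ⊆ T)
    (heq : ∀ a c d, Disjoint (f a) (f c) → Disjoint (f a) (f d) → f c ⊆ T → f d ⊆ T → f c = f d) :
    False := by
  obtain ⟨a, b, c, d, hab, hbc, hcd, hac, had, hbd⟩ := hW.exists_path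
  have nac : a ≠ c := by rintro rfl; exact had hcd
  have nad : a ≠ d := by rintro rfl; exact hac hcd.symm
  have nbd : b ≠ d := by rintro rfl; exact had hab
  obtain ⟨dac, hc⟩ := hin a c nac hac ⟨d, hcd, had⟩
  obtain ⟨dad, hd⟩ := hin a d nad had ⟨c, hcd.symm, hac⟩
  have hbd' := (hΓ.adj_or_disjoint nbd (.inr hd)).resolve_left hbd
  have hbc' := ((hΓ _ _).1 hbc).2.1
  rw [heq a c d dac dad hc hd, Finset.disjoint_iff_inter_eq_empty.1 hbd'] at hbc'
  exact Finset.not_nonempty_empty hbc'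

theorem IsHoleLike.not_isMeetGraph_of_univ [Fintype α] (hW : W.IsHoleLike)
    (hα : Fintype.card α = 4) : ¬ W.IsMeetGraph f Finset.univ := fun hΓ => by
  have hcard : ∀ v, 1 < (f v).card := fun v => by
    by_contra h
    exact hW.not_simplicial v (hΓ.isSimplicialIn (by simpa using h) fun w _ _ =>
      Finset.subset_univ _)
  refine hW.false_of_isMeetGraph hΓ (fun a c hne hac _ =>
    ⟨(hΓ.adj_or_disjoint hne (.inl (Finset.subset_univ _))).resolve_left hac,
      Finset.subset_univ _⟩) fun a c d hac had _ _ => ?_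
  rw [eq_compl_of_disjoint_of_card_four hα (hcard a) (hcard c) hac,
    eq_compl_of_disjoint_of_card_four hα (hcard a) (hcard d) had]

theorem IsHoleLike.not_isMeetGraph_of_card_le_two (hW : W.IsHoleLike) (hne : ∀ v, (f v).Nonempty)
    (hT : T.card ≤ 2) : ¬ W.IsMeetGraph f T := fun hΓ => by
  have hout : ∀ v, ¬ f v ⊆ T → T ⊆ f v := fun v hv => by
    have h : 1 < (f v ∩ T).card := by
      by_contra h
      exact hW.not_simplicial v (hΓ.isSimplicialIn (by omega) fun w _ hw =>
        (((hΓ _ _).1 hw).2.2).resolve_left hv)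
    exact Finset.inter_eq_right.1
      (Finset.eq_of_subset_of_card_le Finset.inter_subset_right (by omega))
  have hmeet : ∀ v, ¬ Disjoint T (f v) := fun v hd => by
    refine hW.not_simplicial v fun w _ _ _ hvw => absurd hvw fun hvw => ?_
    obtain ⟨-, ⟨x, hx⟩, h⟩ := (hΓ _ _).1 hvw
    rw [Finset.mem_inter] at hx
    rcases h with h | h
    · exact Finset.disjoint_left.1 hd (h hx.1) hx.1
    · exact Finset.disjoint_left.1 hd (h hx.2) hx.1
  have hcard : ∀ v, f v ⊆ T → (f v).card ≤ 1 := fun v hv => by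
    by_contra h
    have hfv : f v = T := Finset.eq_of_subset_of_card_le hv (by omega)
    obtain ⟨w, hvw, hnadj⟩ := hW.not_universal v
    have := (hΓ.adj_or_disjoint hvw (.inl hv)).resolve_left hnadj
    exact hmeet w (hfv ▸ this)
  have houtadj : ∀ u v, u ≠ v → f u ⊆ T → ¬ f v ⊆ T → W.Adj u v := fun u v huv hu hv =>
    (hΓ _ _).2 ⟨huv, by rw [Finset.inter_eq_left.2 (hu.trans (hout v hv))]; exact hne u, .inl hu⟩
  refine hW.false_of_isMeetGraph hΓ ?_ ?_
  · rintro a c hac hnadj ⟨d, hcd, had⟩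
    have hc : f a ⊆ T → f c ⊆ T := fun ha => by
      by_contra hc
      exact hnadj (houtadj a c hac ha hc)
    have ha : f a ⊆ T := by
      by_contra ha
      have hnad : a ≠ d := by rintro rfl; exact hnadj hcd.symm
      rcases ((hΓ _ _).1 hcd).2.2 with h | h
      · exact hnadj (houtadj c a hac.symm h ha).symm
      · exact had (houtadj d a hnad.symm h ha).symm
    exact ⟨(hΓ.adj_or_disjoint hac (.inl ha)).resolve_left hnadj, hc ha⟩
  · intro a c d hac had hc hd
    by_contra hcd
    obtain ⟨x, hx⟩ := Finset.card_eq_one.1 (le_antisymm (hcard c hc) (hne c).card_pos)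
    obtain ⟨y, hy⟩ := Finset.card_eq_one.1 (le_antisymm (hcard d hd) (hne d).card_pos)
    rw [hx, hy] at hcd
    have hxy : x ≠ y := fun h => hcd (by rw [h])
    rw [hx, Finset.singleton_subset_iff] at hc
    rw [hy, Finset.singleton_subset_iff] at hd
    have hTxy : ({x, y} : Finset α) = T := Finset.eq_of_subset_of_card_le
      (by simp [Finset.insert_subset_iff, hc, hd]) (by rw [Finset.card_pair hxy]; exact hT)
    refine hmeet a ?_
    rw [← hTxy, Finset.disjoint_insert_left, Finset.disjoint_singleton_left]
    rw [hx, Finset.disjoint_singleton_right] at hac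
    rw [hy, Finset.disjoint_singleton_right] at had
    exact ⟨hac, had⟩

end NoLongHole

theorem IsMeetGraph.of_embedding {V V' α : Type*} [DecidableEq α] {W : SimpleGraph V}
    {Γ : SimpleGraph V'} {f : V' → Finset α} {T : Finset α}
    (hΓ : Γ.IsMeetGraph f T) (φ : W ↪g Γ) : W.IsMeetGraph (f ∘ φ) T := fun v w => by
  rw [← φ.map_adj_iff, hΓ, φ.injective.ne_iff]
  rfl

section Cycle

variable {A : Type*} [AddCommGroup A] [Fintype A] {g : A} {W : SimpleGraph A}

theorem isHoleLike_of_adj_iff (h1 : g ≠ 0) (h2 : g + g ≠ 0) (h3 : g + g + g ≠ 0)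
    (h4 : g + g + g + g ≠ 0) (hW : ∀ u v, W.Adj u v ↔ u - v = g ∨ v - u = g) :
    W.IsHoleLike where
  not_simplicial v h := by
    have := h (v + g) (Finset.mem_univ _) (v - g) (Finset.mem_univ _)
    simp only [hW] at this
    grind
  not_universal v := ⟨v + g + g, by grind⟩
  exists_path := ⟨0, g, g + g, g + g + g, by grind⟩

theorem isHoleLike_compl_of_adj_iff (h1 : g ≠ 0) (h2 : g + g ≠ 0) (h3 : g + g + g ≠ 0)
    (h4 : g + g + g + g ≠ 0) (hW : ∀ u v, W.Adj u v ↔ u - v = g ∨ v - u = g) :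
    Wᶜ.IsHoleLike where
  not_simplicial v h := by
    have := h (v + g + g) (Finset.mem_univ _) (v + g + g + g) (Finset.mem_univ _)
    simp only [compl_adj, hW] at this
    grind
  not_universal v := ⟨v + g, by simp only [compl_adj, hW]; grind⟩
  exists_path := ⟨g + g, 0, g + g + g, g, by simp only [compl_adj, hW]; grind⟩

theorem isHoleLike_cycleGraph {n : ℕ} (hn : 4 < n) :
    (cycleGraph n).IsHoleLike ∧ (cycleGraph n)ᶜ.IsHoleLike := by
  obtain ⟨m, rfl⟩ := Nat.exists_eq_add_of_le' hn
  have h1 : (1 : Fin (m + 5)) ≠ 0 := by simp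
  have h2 : (1 + 1 : Fin (m + 5)) ≠ 0 := by
    simp [Fin.ext_iff, Fin.val_add, Nat.mod_eq_of_lt]
  have h3 : (1 + 1 + 1 : Fin (m + 5)) ≠ 0 := by
    simp [Fin.ext_iff, Fin.val_add, Nat.mod_eq_of_lt]
  have h4 : (1 + 1 + 1 + 1 : Fin (m + 5)) ≠ 0 := by
    simp [Fin.ext_iff, Fin.val_add, Nat.mod_eq_of_lt]
  exact ⟨isHoleLike_of_adj_iff h1 h2 h3 h4 fun _ _ => cycleGraph_adj,
    isHoleLike_compl_of_adj_iff h1 h2 h3 h4 fun _ _ => cycleGraph_adj⟩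

end Cycle

/-- The labels of an induced six-cycle in a meet graph over `Fin 4` with `T = {l}ᶜ`. -/
def hexagonLabel (l : Fin 4) : Fin 6 → Finset (Fin 4) :=
  ![{l + 1}, {l + 1, l + 2, l}, {l + 2}, {l + 2, l + 3, l}, {l + 3}, {l + 3, l + 1, l}]

set_option maxRecDepth 10000 in
theorem isMeetGraph_cycleGraph_six (l : Fin 4) :
    (cycleGraph 6).IsMeetGraph (hexagonLabel l) {l}ᶜ := by
  unfold IsMeetGraph
  revert l
  decide

theorem hexagonLabel_injective (l : Fin 4) : Function.Injective (hexagonLabel l) := by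
  revert l
  decide

theorem hexagonLabel_nonempty (l : Fin 4) (i : Fin 6) : (hexagonLabel l i).Nonempty := by
  revert l i
  decide

theorem IsMeetGraph.cycleGraph_six_isIndContained {V : Type*} {Γ : SimpleGraph V}
    {f : V → Finset (Fin 4)} {T : Finset (Fin 4)} (hΓ : Γ.IsMeetGraph f T) (hT : T.card = 3)
    (hf : ∀ A : Finset (Fin 4), A.Nonempty → ∃ v, f v = A) :
    (cycleGraph 6).IsIndContained Γ := by
  obtain ⟨l, hl⟩ : ∃ l, Tᶜ = {l} := Finset.card_eq_one.1 (by
    rw [Finset.card_compl, hT, Fintype.card_fin])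
  obtain rfl : T = {l}ᶜ := by rw [← hl, compl_compl]
  choose φ hφ using fun i => hf _ (hexagonLabel_nonempty l i)
  have hφi : Function.Injective φ := fun i j h =>
    hexagonLabel_injective l (by rw [← hφ, ← hφ, h])
  refine ⟨⟨⟨φ, hφi⟩, fun {i j} => ?_⟩⟩
  simp only [Function.Embedding.coeFn_mk]
  rw [hΓ, isMeetGraph_cycleGraph_six l, hφ, hφ, hφi.ne_iff]

end SimpleGraph

section PrimeSupport

variable {ι : Type*} [Fintype ι] {p : ι → ℕ}

/-- The indices of those of the numbers `p i` that divide `d`. -/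
def dvdSupport (p : ι → ℕ) (d : ℕ) : Finset ι := Finset.univ.filter fun i => p i ∣ d

@[simp]
theorem mem_dvdSupport {d : ℕ} {i : ι} : i ∈ dvdSupport p d ↔ p i ∣ d := by simp [dvdSupport]

theorem Nat.Prime.exists_eq_of_dvd_prod (hp : ∀ i, (p i).Prime) {q : ℕ} (hq : q.Prime)
    (h : q ∣ ∏ i, p i) : ∃ i, q = p i := by
  obtain ⟨i, -, hi⟩ := (hq.prime.dvd_finsetProd_iff _).1 h
  exact ⟨i, (Nat.prime_dvd_prime_iff_eq hq (hp i)).1 hi⟩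

theorem prod_dvdSupport (hp : ∀ i, (p i).Prime) (hinj : Function.Injective p) {d : ℕ}
    (hd : d ∣ ∏ i, p i) : ∏ i ∈ dvdSupport p d, p i = d := by
  classical
  have hsq : Squarefree (∏ i, p i) := by
    refine Finset.squarefree_prod_of_pairwise_isCoprime (fun i _ j _ hij => ?_)
      fun i _ => (hp i).prime.squarefree
    exact Nat.coprime_iff_isRelPrime.1 ((Nat.coprime_primes (hp i) (hp j)).2 (hinj.ne hij))
  have hd0 : d ≠ 0 := (hsq.squarefree_of_dvd hd).ne_zero
  have himage : (dvdSupport p d).image p = d.primeFactors := by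
    ext q
    simp only [Finset.mem_image, mem_dvdSupport, Nat.mem_primeFactors]
    constructor
    · rintro ⟨i, hi, rfl⟩
      exact ⟨hp i, hi, hd0⟩
    · rintro ⟨hq, hqd, -⟩
      obtain ⟨i, rfl⟩ := hq.exists_eq_of_dvd_prod hp (hqd.trans hd)
      exact ⟨i, hqd, rfl⟩
  have := Nat.prod_primeFactors_of_squarefree (hsq.squarefree_of_dvd hd)
  rwa [← himage, Finset.prod_image hinj.injOn] at this

theorem dvdSupport_prod (hp : ∀ i, (p i).Prime) (hinj : Function.Injective p) (A : Finset ι) :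
    dvdSupport p (∏ i ∈ A, p i) = A := by
  ext i
  rw [mem_dvdSupport]
  refine ⟨fun h => ?_, Finset.dvd_prod_of_mem p⟩
  obtain ⟨j, hj, hij⟩ := ((hp i).prime.dvd_finsetProd_iff _).1 h
  rwa [hinj ((Nat.prime_dvd_prime_iff_eq (hp i) (hp j)).1 hij)]

theorem dvdSupport_subset_iff (hp : ∀ i, (p i).Prime) (hinj : Function.Injective p) {d e : ℕ}
    (hd : d ∣ ∏ i, p i) (he : e ∣ ∏ i, p i) : dvdSupport p d ⊆ dvdSupport p e ↔ d ∣ e := by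
  refine ⟨fun h => ?_, fun h i => by simpa using fun hi => hi.trans h⟩
  rw [← prod_dvdSupport hp hinj hd, ← prod_dvdSupport hp hinj he]
  exact Finset.prod_dvd_prod_of_subset _ _ _ h

theorem dvdSupport_inter_nonempty_iff [DecidableEq ι] (hp : ∀ i, (p i).Prime) {d e : ℕ}
    (hd : d ∣ ∏ i, p i) : (dvdSupport p d ∩ dvdSupport p e).Nonempty ↔ Nat.gcd d e ≠ 1 := by
  constructor
  · rintro ⟨i, hi⟩
    rw [Finset.mem_inter, mem_dvdSupport, mem_dvdSupport] at hi
    exact Nat.Prime.not_coprime_iff_dvd.2 ⟨p i, hp i, hi⟩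
  · intro h
    obtain ⟨q, hq, hqd, hqe⟩ := Nat.Prime.not_coprime_iff_dvd.1 h
    obtain ⟨i, rfl⟩ := hq.exists_eq_of_dvd_prod hp (hqd.trans hd)
    exact ⟨i, by simp [hqd, hqe]⟩

theorem dvdSupport_nonempty (hp : ∀ i, (p i).Prime) {d : ℕ} (hd : d ∣ ∏ i, p i) (h1 : d ≠ 1) :
    (dvdSupport p d).Nonempty := by
  classical
  simpa using (dvdSupport_inter_nonempty_iff hp (e := d) hd).2 (by simpa using h1)

theorem card_dvdSupport_eq_three_iff (hp : ∀ i, (p i).Prime) (hinj : Function.Injective p) {d : ℕ}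
    (hd : d ∣ ∏ i, p i) : (dvdSupport p d).card = 3 ↔
      ∃ q₁ q₂ q₃ : ℕ, q₁.Prime ∧ q₂.Prime ∧ q₃.Prime ∧ d = q₁ * q₂ * q₃ := by
  classical
  have hprod := prod_dvdSupport hp hinj hd
  constructor
  · intro h
    obtain ⟨i, j, k, hij, hik, hjk, hijk⟩ := Finset.card_eq_three.1 h
    refine ⟨p i, p j, p k, hp i, hp j, hp k, ?_⟩
    rw [← hprod, hijk, Finset.prod_insert (by simp [hij, hik]), Finset.prod_pair hjk, mul_assoc]
  · rintro ⟨q₁, q₂, q₃, h₁, h₂, h₃, rfl⟩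
    have hΩ : ∀ A : Finset ι, ArithmeticFunction.cardFactors (∏ i ∈ A, p i) = A.card := fun A => by
      induction A using Finset.induction_on with
      | empty => simp
      | insert a s ha ih =>
        rw [Finset.prod_insert ha, ArithmeticFunction.cardFactors_mul (hp a).ne_zero
          (Finset.prod_ne_zero_iff.2 fun i _ => (hp i).ne_zero), ih,
          ArithmeticFunction.cardFactors_apply_prime (hp a), Finset.card_insert_of_notMem ha,
          add_comm]
    rw [← hΩ, hprod, ArithmeticFunction.cardFactors_mul (mul_ne_zero h₁.ne_zero h₂.ne_zero)
      h₃.ne_zero, ArithmeticFunction.cardFactors_mul h₁.ne_zero h₂.ne_zero,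
      ArithmeticFunction.cardFactors_apply_prime h₁, ArithmeticFunction.cardFactors_apply_prime h₂,
      ArithmeticFunction.cardFactors_apply_prime h₃]

end PrimeSupport

section CyclicGroup

variable {G : Type*} [Group G] [Finite G] [IsCyclic G]

theorem IsCyclic.mem_subgroup_iff_orderOf_dvd (H : Subgroup G) (x : G) :
    x ∈ H ↔ orderOf x ∣ Nat.card H := by
  classical
  refine ⟨fun hx => Subgroup.orderOf_dvd_natCard H hx, fun hx => ?_⟩
  have := Fintype.ofFinite G
  have hsub : Finset.univ.filter (· ∈ H) ⊆ Finset.univ.filter fun y : G => y ^ Nat.card H = 1 := by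
    intro y hy
    simp only [Finset.mem_filter, Finset.mem_univ, true_and] at hy ⊢
    exact orderOf_dvd_iff_pow_eq_one.1 (Subgroup.orderOf_dvd_natCard H hy)
  have hcard : (Finset.univ.filter (· ∈ H)).card = Nat.card H := by
    rw [Nat.card_eq_fintype_card, Fintype.card_subtype]
  have heq := Finset.eq_of_subset_of_card_le hsub
    (by rw [hcard]; exact IsCyclic.card_pow_eq_one_le Nat.card_pos)
  have : x ∈ Finset.univ.filter fun y : G => y ^ Nat.card H = 1 := by
    simpa using orderOf_dvd_iff_pow_eq_one.1 hx
  rw [← heq] at this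
  simpa using this

theorem IsCyclic.exists_orderOf_eq {d : ℕ} (hd : d ∣ Nat.card G) : ∃ x : G, orderOf x = d := by
  obtain ⟨g, hg⟩ := IsCyclic.exists_ofOrder_eq_natCard (α := G)
  exact ⟨g ^ (orderOf g / d), orderOf_pow_orderOf_div (by rw [hg]; exact Nat.card_pos.ne')
    (hg ▸ hd)⟩

variable {ι : Type*} [Fintype ι] [DecidableEq ι] {p : ι → ℕ}

theorem isMeetGraph_genNonCoprimeGraph (hp : ∀ i, (p i).Prime) (hinj : Function.Injective p)
    (hG : Nat.card G = ∏ i, p i) (H : Subgroup G) :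
    (genNonCoprimeGraph H).IsMeetGraph (fun x => dvdSupport p (orderOf (x : G)))
      (dvdSupport p (Nat.card H)) := fun a b => by
  have ho : ∀ x : G, orderOf x ∣ ∏ i, p i := fun x => hG ▸ orderOf_dvd_natCard x
  have hH : Nat.card H ∣ ∏ i, p i := hG ▸ H.card_subgroup_dvd_card
  rw [dvdSupport_inter_nonempty_iff hp (ho _), dvdSupport_subset_iff hp hinj (ho _) hH,
    dvdSupport_subset_iff hp hinj (ho _) hH, ← IsCyclic.mem_subgroup_iff_orderOf_dvd,
    ← IsCyclic.mem_subgroup_iff_orderOf_dvd]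
  rfl

end CyclicGroup

theorem theoremt {G : Type*} [Group G] [Finite G] [IsCyclic G]
    (p : Fin 4 → ℕ) (hp : ∀ i, (p i).Prime) (hinj : Function.Injective p)
    (hG : Nat.card G = p 0 * p 1 * p 2 * p 3)
    (H : Subgroup G) (hH : H ≠ ⊥) :
    IsPerfectGraph (genNonCoprimeGraph H) ∧
    ((¬ ∃ q₁ q₂ q₃ : ℕ, q₁.Prime ∧ q₂.Prime ∧ q₃.Prime ∧ Nat.card H = q₁ * q₂ * q₃) →
      ∀ n : ℕ, 4 < n →
        ¬ (SimpleGraph.cycleGraph n).IsIndContained (genNonCoprimeGraph H) ∧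
        ¬ (SimpleGraph.cycleGraph n)ᶜ.IsIndContained (genNonCoprimeGraph H)) ∧
    ((∃ q₁ q₂ q₃ : ℕ, q₁.Prime ∧ q₂.Prime ∧ q₃.Prime ∧ Nat.card H = q₁ * q₂ * q₃) →
      (SimpleGraph.cycleGraph 6).IsIndContained (genNonCoprimeGraph H)) := by
  rw [← Fin.prod_univ_four] at hG
  have hmeet := isMeetGraph_genNonCoprimeGraph hp hinj hG H
  have hne : ∀ x : {x : G // x ≠ 1}, (dvdSupport p (orderOf (x : G))).Nonempty := fun x =>
    dvdSupport_nonempty hp (hG ▸ orderOf_dvd_natCard _) (mt orderOf_eq_one_iff.1 x.2)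
  rw [← card_dvdSupport_eq_three_iff hp hinj (hG ▸ H.card_subgroup_dvd_card)]
  set T := dvdSupport p (Nat.card H)
  have hT : T.card ≤ 4 := T.card_le_univ
  refine ⟨?_, fun h3 n hn => ?_, fun h3 => ?_⟩
  · by_cases h4 : T.card = 4
    · rw [(Finset.card_eq_iff_eq_univ T).1 h4] at hmeet
      exact hmeet.isPerfectGraph_of_univ (Fintype.card_fin 4) hne
    · exact hmeet.isPerfectGraph_of_card_le_three hne (by omega)
  · have key : ∀ W : SimpleGraph (Fin n), W.IsHoleLike →
        ¬ W.IsIndContained (genNonCoprimeGraph H) := by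
      rintro W hW ⟨φ⟩
      have hφ := hmeet.of_embedding φ
      by_cases h4 : T.card = 4
      · rw [(Finset.card_eq_iff_eq_univ T).1 h4] at hφ
        exact hW.not_isMeetGraph_of_univ (Fintype.card_fin 4) hφ
      · exact hW.not_isMeetGraph_of_card_le_two (fun v => hne (φ v)) (by omega) hφ
    exact ⟨key _ (SimpleGraph.isHoleLike_cycleGraph hn).1,
      key _ (SimpleGraph.isHoleLike_cycleGraph hn).2⟩
  · refine hmeet.cycleGraph_six_isIndContained h3 fun A hA => ?_
    obtain ⟨x, hx⟩ := IsCyclic.exists_orderOf_eq (G := G) (d := ∏ i ∈ A, p i)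
      (hG ▸ Finset.prod_dvd_prod_of_subset _ _ _ (Finset.subset_univ A))
    have hsupp : dvdSupport p (orderOf x) = A := by rw [hx, dvdSupport_prod hp hinj]
    refine ⟨⟨x, ?_⟩, hsupp⟩
    rintro rfl
    obtain ⟨i, hi⟩ := hA
    rw [← hsupp, mem_dvdSupport, orderOf_one] at hi
    exact (hp i).one_lt.ne' (Nat.dvd_one.1 hi)
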